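/- Let $d_1<d_2<d_3$ be integers with $d_1\ge 3$ and $\gcd(d_1,d_2,d_3)=1$, none of which is a nonnegative integer combination of the other two, and let $S_3=\langle d_1,d_2,d_3\rangle\ni 0$ be the numerical semigroup they minimally generate. Let $\Delta_3=\mathbb Z_{>0}\setminus S_3$ be its (finite) set of gaps, $F_3=\max\Delta_3$, $G_r=\sum_{s\in\Delta_3}s^r$, $\sigma_k=d_1^k+d_2^k+d_3^k$, $\delta_k=(\sigma_k-1)/2^k$, $\pi_3=d_1d_2d_3$, $g_3=F_3+\sigma_1$, and $$K_0=G_0+\delta_1,\qquad K_2=G_2+\sigma_1G_1+\frac{3\sigma_1^2+\sigma_2}{12}\,G_0+\frac{\delta_1(\delta_1^2+\delta_2)}{3},$$ $$h_0=\frac{K_0}{g_3},\qquad h_2=\frac{K_2}{g_3^3},\qquad v=\frac{\pi_3}{g_3^2}.$$ Then there are integers $x_1,x_2,x_3,y\in[0,g_3)$ (degrees of syzygies) such that $$\sum_{s\in S_3}t^s=\frac{1-t^{x_1}-t^{x_2}-t^{x_3}+t^{y}+t^{g_3}}{(1-t^{d_1})(1-t^{d_2})(1-t^{d_3})},$$ and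 for every such choice of $x_1,x_2,x_3,y$, with $u=(y+g_3)/g_3$, $$12h_2=(2h_0-1)\,u(u-1)+2h_0(1-v).$$ Moreover, $$\frac1{18}<h_2<\frac19 .$$ -/

import Mathlib

noncomputable section

namespace NumSemi3

/-- The additive submonoid `⟨d₁, d₂, d₃⟩` of `ℕ`; it contains `0`. -/
def semigroup (d₁ d₂ d₃ : ℕ) : AddSubmonoid ℕ :=
  AddSubmonoid.closure {d₁, d₂, d₃}

/-- `⟨d₁, d₂, d₃⟩` is a numerical semigroup minimally generated by `d₁ < d₂ < d₃`: the generators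
have greatest common divisor `1`, and none of them is a combination of the other two with
nonnegative integer coefficients. -/
structure IsMinimalTriple (d₁ d₂ d₃ : ℕ) : Prop where
  three_le : 3 ≤ d₁
  lt₁₂ : d₁ < d₂
  lt₂₃ : d₂ < d₃
  gcd_eq_one : Nat.gcd (Nat.gcd d₁ d₂) d₃ = 1
  notMem₁ : d₁ ∉ AddSubmonoid.closure ({d₂, d₃} : Set ℕ)
  notMem₂ : d₂ ∉ AddSubmonoid.closure ({d₁, d₃} : Set ℕ)
  notMem₃ : d₃ ∉ AddSubmonoid.closure ({d₁, d₂} : Set ℕ)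

/-- The set of gaps (positive integers outside the semigroup). -/
def gaps (d₁ d₂ d₃ : ℕ) : Set ℕ :=
  {s | 0 < s ∧ s ∉ semigroup d₁ d₂ d₃}

/-- The higher genera `G_r = ∑ s ^ r`, the sum over the gaps `s`. -/
def genus (d₁ d₂ d₃ r : ℕ) : ℚ :=
  ∑ᶠ s ∈ gaps d₁ d₂ d₃, (s : ℚ) ^ r

/-- The Frobenius number `F₃`, the largest gap. -/
def frobenius (d₁ d₂ d₃ : ℕ) : ℕ :=
  sSup (gaps d₁ d₂ d₃)

/-- The power sums `σ_k = d₁ ^ k + d₂ ^ k + d₃ ^ k`. -/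
def sigma (d₁ d₂ d₃ k : ℕ) : ℕ :=
  d₁ ^ k + d₂ ^ k + d₃ ^ k

/-- `δ_k = (σ_k - 1) / 2 ^ k`. -/
def delta (d₁ d₂ d₃ k : ℕ) : ℚ :=
  ((sigma d₁ d₂ d₃ k : ℚ) - 1) / 2 ^ k

/-- `g₃ = F₃ + σ₁`. -/
def g (d₁ d₂ d₃ : ℕ) : ℕ :=
  frobenius d₁ d₂ d₃ + sigma d₁ d₂ d₃ 1

/-- `K₀ = G₀ + δ₁`. -/
def K0 (d₁ d₂ d₃ : ℕ) : ℚ :=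
  genus d₁ d₂ d₃ 0 + delta d₁ d₂ d₃ 1

/-- `K₂ = G₂ + σ₁ G₁ + (3 σ₁² + σ₂) / 12 * G₀ + δ₁ (δ₁² + δ₂) / 3`. -/
def K2 (d₁ d₂ d₃ : ℕ) : ℚ :=
  genus d₁ d₂ d₃ 2 + sigma d₁ d₂ d₃ 1 * genus d₁ d₂ d₃ 1
    + (3 * (sigma d₁ d₂ d₃ 1 : ℚ) ^ 2 + sigma d₁ d₂ d₃ 2) / 12 * genus d₁ d₂ d₃ 0
    + delta d₁ d₂ d₃ 1 * (delta d₁ d₂ d₃ 1 ^ 2 + delta d₁ d₂ d₃ 2) / 3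

/-- The rescaled genus `h₀ = K₀ / g₃`. -/
def h0 (d₁ d₂ d₃ : ℕ) : ℚ :=
  K0 d₁ d₂ d₃ / g d₁ d₂ d₃

/-- The rescaled genus `h₂ = K₂ / g₃ ^ 3`. -/
def h2 (d₁ d₂ d₃ : ℕ) : ℚ :=
  K2 d₁ d₂ d₃ / (g d₁ d₂ d₃ : ℚ) ^ 3

/-- `v = π₃ / g₃ ^ 2` with `π₃ = d₁ d₂ d₃`. -/
def v (d₁ d₂ d₃ : ℕ) : ℚ :=
  ((d₁ * d₂ * d₃ : ℕ) : ℚ) / (g d₁ d₂ d₃ : ℚ) ^ 2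

/-- `u = Y₁ / g₃` with `Y₁ = y + g₃`, where `y` is the second of the two degrees `y`, `g₃`. -/
def u (d₁ d₂ d₃ y : ℕ) : ℚ :=
  ((y : ℚ) + g d₁ d₂ d₃) / g d₁ d₂ d₃

/-- The Hilbert series `∑ t ^ s`, the sum over the elements `s` of the semigroup. -/
def hilbertSeries (d₁ d₂ d₃ : ℕ) : PowerSeries ℤ :=
  PowerSeries.mk (Set.indicator (semigroup d₁ d₂ d₃ : Set ℕ) 1)

open PowerSeries in
/-- `x₁, x₂, x₃` and `y, g₃` are degrees of syzygies: the Hilbert series is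
`(1 - t ^ x₁ - t ^ x₂ - t ^ x₃ + t ^ y + t ^ g₃) / ((1 - t ^ d₁) (1 - t ^ d₂) (1 - t ^ d₃))`,
and `g₃` is larger than the other four degrees. -/
structure IsSyzygyDegrees (d₁ d₂ d₃ x₁ x₂ x₃ y : ℕ) : Prop where
  hilbert : (1 - X ^ d₁) * (1 - X ^ d₂) * (1 - X ^ d₃) * hilbertSeries d₁ d₂ d₃
    = 1 - X ^ x₁ - X ^ x₂ - X ^ x₃ + X ^ y + X ^ g d₁ d₂ d₃
  x₁_lt : x₁ < g d₁ d₂ d₃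
  x₂_lt : x₂ < g d₁ d₂ d₃
  x₃_lt : x₃ < g d₁ d₂ d₃
  y_lt : y < g d₁ d₂ d₃

/-- The gaps are finite in number, so that the sums `genus` are genuine. -/
theorem IsMinimalTriple.finite_gaps {d₁ d₂ d₃ : ℕ} (h : IsMinimalTriple d₁ d₂ d₃) :
    (gaps d₁ d₂ d₃).Finite := by
  obtain ⟨n, hn⟩ := Nat.exists_mem_closure_of_ge ({d₁, d₂, d₃} : Set ℕ)
  have hg : Nat.setGcd ({d₁, d₂, d₃} : Set ℕ) = 1 := by
    rw [← Nat.dvd_one, ← h.gcd_eq_one]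
    exact Nat.dvd_gcd (Nat.dvd_gcd (Nat.setGcd_dvd_of_mem (by simp))
      (Nat.setGcd_dvd_of_mem (by simp))) (Nat.setGcd_dvd_of_mem (by simp))
  refine (Set.finite_lt_nat n).subset fun s hs => ?_
  by_contra hlt
  exact hs.2 (hn s (not_lt.mp hlt) (by simp [hg]))

/-- `frobenius` is the Frobenius number in the sense of Mathlib. -/
theorem IsMinimalTriple.frobeniusNumber {d₁ d₂ d₃ : ℕ} (h : IsMinimalTriple d₁ d₂ d₃) :
    FrobeniusNumber (frobenius d₁ d₂ d₃) {d₁, d₂, d₃} := by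
  have h3 := h.three_le
  have h12 := h.lt₁₂
  have h23 := h.lt₂₃
  have hne : (gaps d₁ d₂ d₃).Nonempty := by
    refine ⟨1, one_pos, fun hmem => ?_⟩
    have hsub : AddSubmonoid.closure ({d₁, d₂, d₃} : Set ℕ) ≤
        { carrier := {n | n = 0 ∨ 3 ≤ n}
          zero_mem' := Or.inl rfl
          add_mem' := by
            intro a b ha hb
            simp only [Set.mem_ofPred_eq] at ha hb ⊢
            omega } := by
      rw [AddSubmonoid.closure_le]
      rintro x (rfl | rfl | rfl)
      · exact Or.inr (by omega)
      · exact Or.inr (by omega)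
      · exact Or.inr (by omega)
    rcases hsub hmem with h1 | h1 <;> omega
  have hbdd := h.finite_gaps.bddAbove
  rw [frobeniusNumber_iff]
  refine ⟨(Nat.sSup_mem hne hbdd).2, fun k hk => ?_⟩
  by_contra hk'
  exact absurd (le_csSup hbdd (show k ∈ gaps d₁ d₂ d₃ from ⟨by omega, hk'⟩)) (not_le.mpr hk)

end NumSemi3

end

/-! The least semigroup element in each class modulo d₁ (the Apéry set) is written as m d₂ + n d₃
with m least, giving one pair (m, n) per class. These pairs are closed downwards, and the weight at
an inner corner of the staircase is divisible by d₁ (`dvd_of_interior_corner`), which allows at most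
one such corner. So the region is a rectangle or an L (`isLexMin_shape`), and its generating
function is the required numerator.

The identity needs only the shape of the numerator. Its moments of order 1, 2, 3, 5 express power
sums of the degrees through π₃, K₀ and K₂. For three numbers x₁, x₂, x₃ the fifth power sum is a
polynomial in the first three, and this is the identity (`IsMinimalTriple.twelve_mul_K2`).

For the bounds, the degrees are chosen with every xᵢ ≤ y. With p, q, r = (y - xᵢ)/g₃ ≥ 0 one gets
(2h₀ - 1)v = pqr, whence 0 ≤ 2h₀ - 1 ≤ 1/9 and 0 < v < 1/3; the identity then yields both
inequalities. -/

namespace NumSemi3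

/-! ### The staircase of minimal pairs. -/

/-- `(m, n)` minimizes the weight `m * b + n * c`, and then `m`, among all pairs whose weight lies
in the same residue class modulo `a`. -/
def IsLexMin (a b c m n : ℕ) : Prop :=
  ∀ m' n' : ℕ, (a : ℤ) ∣ (m' * b + n' * c) - (m * b + n * c) →
    m * b + n * c < m' * b + n' * c ∨ m * b + n * c = m' * b + n' * c ∧ m ≤ m'

section IsLexMin

variable {a b c m n m' n' : ℕ}

theorem exists_isLexMin (a b c m n : ℕ) :
    ∃ m' n' : ℕ, IsLexMin a b c m' n' ∧ (a : ℤ) ∣ (m * b + n * c) - (m' * b + n' * c) ∧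
      m' * b + n' * c ≤ m * b + n * c := by
  let f : ℕ × ℕ → ℕ ×ₗ ℕ := fun p => toLex (p.1 * b + p.2 * c, p.1)
  obtain ⟨⟨p, q⟩, hp, hmin⟩ := (InvImage.wf f wellFounded_lt).has_min
    {p : ℕ × ℕ | (a : ℤ) ∣ (m * b + n * c) - (p.1 * b + p.2 * c)} ⟨(m, n), by simp⟩
  have key : ∀ m' n' : ℕ, (a : ℤ) ∣ (m * b + n * c) - (m' * b + n' * c) →
      p * b + q * c < m' * b + n' * c ∨ p * b + q * c = m' * b + n' * c ∧ p ≤ m' := by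
    intro m' n' h
    have h1 : ¬ f (m', n') < f (p, q) := hmin (m', n') h
    simp only [f, Prod.Lex.toLex_lt_toLex, not_or, not_and, not_lt] at h1
    rcases h1.1.lt_or_eq with h2 | h2
    · exact Or.inl h2
    · exact Or.inr ⟨h2, h1.2 h2.symm⟩
  refine ⟨p, q, fun m' n' h => key m' n' ?_, hp, ?_⟩
  · have := dvd_sub hp h
    exact this.trans (Eq.dvd (by ring))
  · rcases key m n (by simp) with h | h
    · exact h.le
    · exact h.1.le

theorem IsLexMin.eq (hc : 0 < c) (h : IsLexMin a b c m n) (h' : IsLexMin a b c m' n')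
    (hd : (a : ℤ) ∣ (m' * b + n' * c) - (m * b + n * c)) : m = m' ∧ n = n' := by
  have h1 := h m' n' hd
  have h2 := h' m n (by rw [← dvd_neg]; exact hd.trans (Eq.dvd (by ring)))
  have hm : m = m' := by omega
  subst hm
  have : n * c = n' * c := by omega
  exact ⟨rfl, Nat.eq_of_mul_eq_mul_right hc this⟩

/-- A competitor of the smaller pair, shifted by the difference of the two pairs, becomes a
competitor of the larger one. -/
theorem IsLexMin.mono (h : IsLexMin a b c m n) (hm : m' ≤ m) (hn : n' ≤ n) :
    IsLexMin a b c m' n' := by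
  obtain ⟨i, rfl⟩ := Nat.exists_eq_add_of_le hm
  obtain ⟨j, rfl⟩ := Nat.exists_eq_add_of_le hn
  intro p q hd
  have := h (p + i) (q + j) (by push_cast; exact hd.trans (Eq.dvd (by ring)))
  simp only [add_mul] at this
  omega

theorem isLexMin_zero (a b c : ℕ) : IsLexMin a b c 0 0 := by
  intro m n _
  rcases Nat.eq_zero_or_pos (m * b + n * c) with h | h
  · right; omega
  · left; omega

theorem not_isLexMin_left (ha : 0 < a) (hb : 0 < b) : ¬ IsLexMin a b c a 0 := by
  intro h
  have := h 0 0 (by simp)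
  have := Nat.mul_pos ha hb
  omega

theorem not_isLexMin_right (ha : 0 < a) (hc : 0 < c) : ¬ IsLexMin a b c 0 a := by
  intro h
  have := h 0 0 (by simp)
  have := Nat.mul_pos ha hc
  omega

/-- Take the minimal pair in the class of the corner. A positive coordinate could be lowered by one,
giving a minimal pair congruent to, hence equal to, a neighbour of the corner. Then the corner would
itself be minimal, or a coordinate m + 1 would vanish. So the minimal pair is (0, 0). -/
theorem dvd_of_interior_corner (hc : 0 < c) (h : ¬ IsLexMin a b c (m + 1) (n + 1))
    (h₁ : IsLexMin a b c m (n + 1)) (h₂ : IsLexMin a b c (m + 1) n) :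
    (a : ℤ) ∣ (m + 1) * b + (n + 1) * c := by
  obtain ⟨p, q, hpq, hd, -⟩ := exists_isLexMin a b c (m + 1) (n + 1)
  push_cast at hd
  rcases p with _ | p
  · rcases q with _ | q
    · simpa using hd
    · have := (hpq.mono le_rfl q.le_succ).eq hc h₂
        (by push_cast at hd ⊢; exact hd.trans (Eq.dvd (by ring)))
      omega
  · obtain ⟨rfl, rfl⟩ := (hpq.mono p.le_succ le_rfl).eq hc h₁
      (by push_cast at hd ⊢; exact hd.trans (Eq.dvd (by ring)))
    exact absurd hpq h

theorem exists_of_left_corner (hc : 0 < c) (h : ¬ IsLexMin a b c (m + 1) 0)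
    (h₁ : IsLexMin a b c m 0) :
    ∃ q : ℕ, IsLexMin a b c 0 q ∧ (a : ℤ) ∣ (m + 1) * b - q * c ∧ q * c ≤ (m + 1) * b := by
  obtain ⟨p, q, hpq, hd, hle⟩ := exists_isLexMin a b c (m + 1) 0
  push_cast at hd
  rcases p with _ | p
  · exact ⟨q, hpq, by simpa using hd, by simpa using hle⟩
  · obtain ⟨rfl, rfl⟩ := (hpq.mono p.le_succ le_rfl).eq hc h₁
      (by push_cast at hd ⊢; exact hd.trans (Eq.dvd (by ring)))
    exact absurd hpq h

theorem exists_of_right_corner (hc : 0 < c) (h : ¬ IsLexMin a b c 0 (n + 1))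
    (h₁ : IsLexMin a b c 0 n) :
    ∃ p : ℕ, IsLexMin a b c p 0 ∧ (a : ℤ) ∣ (n + 1) * c - p * b ∧ p * b ≤ (n + 1) * c := by
  obtain ⟨p, q, hpq, hd, hle⟩ := exists_isLexMin a b c 0 (n + 1)
  push_cast at hd
  rcases q with _ | q
  · exact ⟨p, hpq, by simpa using hd, by simpa using hle⟩
  · obtain ⟨rfl, rfl⟩ := (hpq.mono le_rfl q.le_succ).eq hc h₁
      (by push_cast at hd ⊢; exact hd.trans (Eq.dvd (by ring)))
    exact absurd hpq h

/-- A pair outside lies above a corner. -/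
theorem exists_corner_le (hm : IsLexMin a b c m 0) (hn : IsLexMin a b c 0 n)
    (h : ¬ IsLexMin a b c m n) :
    ∃ p q : ℕ, p + 1 ≤ m ∧ q + 1 ≤ n ∧ ¬ IsLexMin a b c (p + 1) (q + 1) ∧
      IsLexMin a b c p (q + 1) ∧ IsLexMin a b c (p + 1) q := by
  classical
  have hex : ∃ i, ¬ IsLexMin a b c i n := ⟨m, h⟩
  obtain ⟨p, hp⟩ : ∃ p, Nat.find hex = p + 1 :=
    Nat.exists_eq_succ_of_ne_zero fun h0 => (h0 ▸ Nat.find_spec hex) hn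
  have hpm : p + 1 ≤ m := hp ▸ Nat.find_min' hex h
  have hp1 : ¬ IsLexMin a b c (p + 1) n := hp ▸ Nat.find_spec hex
  have hp2 : IsLexMin a b c p n := not_not.mp (Nat.find_min hex (by omega))
  have hex' : ∃ j, ¬ IsLexMin a b c (p + 1) j := ⟨n, hp1⟩
  obtain ⟨q, hq⟩ : ∃ q, Nat.find hex' = q + 1 :=
    Nat.exists_eq_succ_of_ne_zero fun h0 => (h0 ▸ Nat.find_spec hex') (hm.mono hpm le_rfl)
  have hqn : q + 1 ≤ n := hq ▸ Nat.find_min' hex' hp1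
  exact ⟨p, q, hpm, hqn, hq ▸ Nat.find_spec hex', hp2.mono le_rfl hqn,
    not_not.mp (Nat.find_min hex' (by omega))⟩

/-- Two corners off the axes coincide. -/
theorem interior_corner_unique (hc : 0 < c) {p q : ℕ}
    (h : ¬ IsLexMin a b c (m + 1) (n + 1))
    (h₁ : IsLexMin a b c m (n + 1)) (h₂ : IsLexMin a b c (m + 1) n)
    (h' : ¬ IsLexMin a b c (p + 1) (q + 1))
    (h₁' : IsLexMin a b c p (q + 1)) (h₂' : IsLexMin a b c (p + 1) q) :
    p = m ∧ q = n := by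
  wlog hmp : m ≤ p generalizing m n p q
  · have := this h' h₁' h₂' h h₁ h₂ (by omega)
    omega
  -- Both corner weights vanish modulo a, so their horizontal and vertical offsets i, j satisfy i b
  -- ≡ j c; both (i, 0) and (0, j) are minimal, forcing i = j = 0.
  have hd := dvd_sub (dvd_of_interior_corner hc h h₁ h₂) (dvd_of_interior_corner hc h' h₁' h₂')
  have hqn : q ≤ n := by
    by_contra hlt
    exact h (h₂'.mono (by omega) (by omega))
  obtain ⟨i, rfl⟩ := Nat.exists_eq_add_of_le hmp
  obtain ⟨j, rfl⟩ := Nat.exists_eq_add_of_le hqn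
  have e1 : IsLexMin a b c i 0 := h₂'.mono (by omega) (by omega)
  have e2 : IsLexMin a b c 0 j := h₁.mono (by omega) (by omega)
  obtain ⟨h3, h4⟩ := e1.eq hc e2 (by push_cast at hd ⊢; exact hd.trans (Eq.dvd (by ring)))
  omega

/-- The pairs `(m, n)` with `IsLexMin a b c m n` form a rectangle or an L-shape. -/
theorem isLexMin_shape (ha : 0 < a) (hb : 0 < b) (hc : 0 < c) :
    (∃ A B : ℕ, 0 < A ∧ 0 < B ∧ ∀ m n, IsLexMin a b c m n ↔ m < A ∧ n < B) ∨
    ∃ C D E F k l : ℕ, 0 < C ∧ 0 < D ∧ 0 < E ∧ 0 < F ∧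
      (C + E) * b = k * a + F * c ∧ (D + F) * c = l * a + E * b ∧
      ∀ m n, IsLexMin a b c m n ↔ m < C + E ∧ n < D + F ∧ (m < C ∨ n < D) := by
  classical
  have hexA : ∃ m, ¬ IsLexMin a b c m 0 := ⟨a, not_isLexMin_left ha hb⟩
  have hexB : ∃ n, ¬ IsLexMin a b c 0 n := ⟨a, not_isLexMin_right ha hc⟩
  obtain ⟨A, hA⟩ : ∃ p, Nat.find hexA = p + 1 :=
    Nat.exists_eq_succ_of_ne_zero fun h0 => (h0 ▸ Nat.find_spec hexA) (isLexMin_zero a b c)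
  obtain ⟨B, hB⟩ : ∃ p, Nat.find hexB = p + 1 :=
    Nat.exists_eq_succ_of_ne_zero fun h0 => (h0 ▸ Nat.find_spec hexB) (isLexMin_zero a b c)
  have hA1 : ¬ IsLexMin a b c (A + 1) 0 := hA ▸ Nat.find_spec hexA
  have hB1 : ¬ IsLexMin a b c 0 (B + 1) := hB ▸ Nat.find_spec hexB
  have hA2 : IsLexMin a b c A 0 := not_not.mp (Nat.find_min hexA (by omega))
  have hB2 : IsLexMin a b c 0 B := not_not.mp (Nat.find_min hexB (by omega))
  have hA3 : ∀ {m n}, IsLexMin a b c m n → m < A + 1 := fun h => by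
    by_contra hlt
    exact hA1 (h.mono (by omega) (by omega))
  have hB3 : ∀ {m n}, IsLexMin a b c m n → n < B + 1 := fun h => by
    by_contra hlt
    exact hB1 (h.mono (by omega) (by omega))
  by_cases hAB : IsLexMin a b c A B
  · exact Or.inl ⟨A + 1, B + 1, A.succ_pos, B.succ_pos, fun m n =>
      ⟨fun h => ⟨hA3 h, hB3 h⟩, fun h => hAB.mono (by omega) (by omega)⟩⟩
  right
  obtain ⟨C, D, hCA, hDB, h0, h1, h2⟩ := exists_corner_le hA2 hB2 hAB
  have hshape : ∀ m n, IsLexMin a b c m n ↔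
      m < A + 1 ∧ n < B + 1 ∧ (m < C + 1 ∨ n < D + 1) := by
    intro m n
    refine ⟨fun h => ⟨hA3 h, hB3 h, ?_⟩, fun ⟨hm, hn, hmn⟩ => ?_⟩
    · by_contra hlt
      exact h0 (h.mono (by omega) (by omega))
    · by_contra h
      obtain ⟨p, q, hp, hq, g0, g1, g2⟩ := exists_corner_le (hA2.mono (by omega) le_rfl)
        (hB2.mono le_rfl (by omega)) h
      have := interior_corner_unique hc h0 h1 h2 g0 g1 g2
      omega
  obtain ⟨E, rfl⟩ := Nat.exists_eq_add_of_le hCA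
  obtain ⟨F, rfl⟩ := Nat.exists_eq_add_of_le hDB
  obtain ⟨q, hq, hqd, hqle⟩ := exists_of_left_corner hc hA1 hA2
  obtain ⟨p, hp, hpd, hple⟩ := exists_of_right_corner hc hB1 hB2
  have hd := dvd_of_interior_corner hc h0 h1 h2
  have hp' := hA3 hp
  have hq' := hB3 hq
  push_cast at hpd hqd
  -- The inner corner and the left corner together give (E + 1) b ≡ (D + 1 + q) c. If q ≤ F, both
  -- sides come from minimal pairs, on different axes.
  have hqF : F + 1 ≤ q := by
    by_contra hlt
    have e1 : IsLexMin a b c (E + 1) 0 := hA2.mono (by omega) le_rfl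
    have e2 : IsLexMin a b c 0 (D + 1 + q) := hB2.mono le_rfl (by omega)
    have := e1.eq hc e2 (by
      have := dvd_sub hd hqd
      push_cast
      exact this.trans (Eq.dvd (by ring)))
    omega
  obtain ⟨i, rfl⟩ := Nat.exists_eq_add_of_le hqF
  have e1 : IsLexMin a b c (E + 1) 0 := hA2.mono (by omega) le_rfl
  -- Adding the right corner's relation turns this into (E + 1) b ≡ p b + i c. The bound on q gives
  -- i ≤ D, so (p, i) lies in the L, and uniqueness yields p = E + 1, i = 0.
  have e2 : IsLexMin a b c p i := (hshape _ _).2 ⟨by omega, by omega, by omega⟩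
  have := e1.eq hc e2 (by
    have := dvd_sub (dvd_sub hd hqd) hpd
    push_cast at this ⊢
    exact this.trans (Eq.dvd (by ring)))
  obtain ⟨rfl, rfl⟩ := this
  have mk : ∀ s t : ℕ, t ≤ s → (a : ℤ) ∣ s - t → ∃ k : ℕ, s = k * a + t := by
    intro s t hst hdvd
    rw [← Nat.cast_sub hst, Int.natCast_dvd_natCast] at hdvd
    obtain ⟨k, hk⟩ := hdvd
    exact ⟨k, by rw [mul_comm k, ← hk]; omega⟩
  obtain ⟨k, hk⟩ := mk _ _ hqle (by push_cast; exact_mod_cast hqd)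
  obtain ⟨l, hl⟩ := mk _ _ hple (by push_cast; exact_mod_cast hpd)
  exact ⟨C + 1, D + 1, E + 1, F + 1, k, l, by omega, by omega, by omega, by omega,
    by linarith, by linarith, fun m n => by rw [hshape]; omega⟩

end IsLexMin

/-! ### The Apéry set, the Hilbert series and the Frobenius number. -/

theorem mem_semigroup_iff {a b c s : ℕ} :
    s ∈ semigroup a b c ↔ ∃ k m n : ℕ, s = k * a + m * b + n * c := by
  constructor
  · intro h
    induction h using AddSubmonoid.closure_induction with
    | mem x hx =>
      rcases hx with rfl | rfl | rfl
      · exact ⟨1, 0, 0, by ring⟩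
      · exact ⟨0, 1, 0, by ring⟩
      · exact ⟨0, 0, 1, by ring⟩
    | zero => exact ⟨0, 0, 0, by ring⟩
    | add x y _ _ hx hy =>
      obtain ⟨k, m, n, rfl⟩ := hx
      obtain ⟨k', m', n', rfl⟩ := hy
      exact ⟨k + k', m + m', n + n', by ring⟩
  · rintro ⟨k, m, n, rfl⟩
    have key : ∀ x ∈ ({a, b, c} : Set ℕ), ∀ i : ℕ, i * x ∈ semigroup a b c := fun x hx i => by
      simpa using (semigroup a b c).nsmul_mem (AddSubmonoid.subset_closure hx) i
    exact add_mem (add_mem (key a (by simp) k) (key b (by simp) m)) (key c (by simp) n)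

theorem mem_semigroup_iff_of_isLexMin {a b c m n s : ℕ} (h : IsLexMin a b c m n)
    (hs : (a : ℤ) ∣ s - (m * b + n * c)) : s ∈ semigroup a b c ↔ m * b + n * c ≤ s := by
  rw [mem_semigroup_iff]
  constructor
  · rintro ⟨k, p, q, rfl⟩
    have := h p q (by
      have := dvd_sub hs (Dvd.intro (k : ℤ) rfl)
      push_cast at this
      exact this.trans (Eq.dvd (by ring)))
    have := Nat.zero_le (k * a)
    omega
  · intro hle
    have : (a : ℤ) ∣ ((s - (m * b + n * c) : ℕ) : ℤ) := by
      rw [Nat.cast_sub hle]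
      exact_mod_cast hs
    obtain ⟨k, hk⟩ := Int.natCast_dvd_natCast.mp this
    exact ⟨k, m, n, by rw [mul_comm k, ← hk]; omega⟩

theorem IsMinimalTriple.exists_isLexMin_of_residue {a b c : ℕ} (h : IsMinimalTriple a b c)
    (s : ℕ) : ∃ m n : ℕ, IsLexMin a b c m n ∧ (a : ℤ) ∣ s - (m * b + n * c) := by
  obtain ⟨M, hM⟩ := h.finite_gaps.bddAbove
  have h3 := h.three_le
  -- Shifting s past all gaps by a multiple of a keeps its class and puts it in the semigroup.
  have hlt : M < s + (M + 1) * a := by nlinarith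
  have hmem : s + (M + 1) * a ∈ semigroup a b c := by
    by_contra hn
    exact absurd (hM (show s + (M + 1) * a ∈ gaps a b c from ⟨by omega, hn⟩)) (by omega)
  obtain ⟨k, m, n, hk⟩ := mem_semigroup_iff.mp hmem
  obtain ⟨p, q, hpq, hd, -⟩ := exists_isLexMin a b c m n
  refine ⟨p, q, hpq, ?_⟩
  have hk' : (s : ℤ) = k * a + m * b + n * c - (M + 1) * a := by
    rw [eq_sub_iff_add_eq]; exact_mod_cast hk
  have := dvd_add hd (Dvd.intro ((k : ℤ) - (M + 1)) rfl)
  exact this.trans (Eq.dvd (by rw [hk']; ring))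

open PowerSeries in
/-- The Hilbert series of the Apéry set with respect to `a`. -/
theorem IsMinimalTriple.one_sub_mul_hilbertSeries {a b c : ℕ} (h : IsMinimalTriple a b c)
    {L : Finset (ℕ × ℕ)} (hL : ∀ p : ℕ × ℕ, p ∈ L ↔ IsLexMin a b c p.1 p.2) :
    (1 - X ^ a) * hilbertSeries a b c = ∑ p ∈ L, X ^ (p.1 * b + p.2 * c) := by
  classical
  have h3 := h.three_le
  have h12 := h.lt₁₂
  have h23 := h.lt₂₃
  ext s
  obtain ⟨m, n, hmn, hd⟩ := h.exists_isLexMin_of_residue s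
  have hsum : (∑ p ∈ L, if s = p.1 * b + p.2 * c then (1 : ℤ) else 0)
      = if s = m * b + n * c then 1 else 0 := by
    rw [Finset.sum_eq_single (m, n)]
    · rintro ⟨p, q⟩ hp hne
      rw [if_neg]
      rintro rfl
      push_cast at hd
      obtain ⟨rfl, rfl⟩ := hmn.eq (by omega) ((hL _).1 hp) (by simpa using hd)
      exact hne rfl
    · intro hn
      exact absurd ((hL _).2 hmn) hn
  rw [sub_mul, one_mul, map_sub, coeff_X_pow_mul', map_sum]
  simp only [coeff_X_pow, hsum, hilbertSeries, coeff_mk, Set.indicator_apply, SetLike.mem_coe,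
    Pi.one_apply]
  rw [mem_semigroup_iff_of_isLexMin hmn hd]
  by_cases has : a ≤ s
  · have hd' : (a : ℤ) ∣ ((s - a : ℕ) : ℤ) - (m * b + n * c) := by
      rw [Nat.cast_sub has]
      have := dvd_sub hd (dvd_refl (a : ℤ))
      exact this.trans (Eq.dvd (by ring))
    rw [if_pos has, mem_semigroup_iff_of_isLexMin hmn hd']
    have hkey : m * b + n * c ≤ s → m * b + n * c ≤ s - a ∨ s = m * b + n * c := by
      intro hle
      have h1 : (a : ℤ) ∣ ((s - (m * b + n * c) : ℕ) : ℤ) := by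
        rw [Nat.cast_sub hle]
        exact_mod_cast hd
      obtain h0 | h0 := Nat.eq_zero_or_pos (s - (m * b + n * c))
      · omega
      · have := Nat.le_of_dvd h0 (Int.natCast_dvd_natCast.mp h1)
        omega
    by_cases h1 : m * b + n * c ≤ s
    · rcases hkey h1 with h2 | h2
      · rw [if_pos h1, if_pos h2, if_neg (by omega)]; rfl
      · rw [if_pos h1, if_neg (by omega), if_pos h2]; rfl
    · rw [if_neg h1, if_neg (by omega), if_neg (by omega)]; rfl
  · rw [if_neg has, sub_zero]
    have hkey : m * b + n * c ≤ s → s = m * b + n * c := by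
      intro hle
      have h1 : (a : ℤ) ∣ ((s - (m * b + n * c) : ℕ) : ℤ) := by
        rw [Nat.cast_sub hle]
        exact_mod_cast hd
      have := Nat.eq_zero_of_dvd_of_lt (Int.natCast_dvd_natCast.mp h1) (by omega)
      omega
    by_cases h1 : m * b + n * c ≤ s
    · rw [if_pos h1, if_pos (hkey h1)]
    · rw [if_neg h1, if_neg (by omega)]

/-- The largest element of the Apéry set is `F₃ + d₁`. -/
theorem IsMinimalTriple.frobenius_add {a b c : ℕ} (h : IsMinimalTriple a b c) :
    (∀ m n, IsLexMin a b c m n → m * b + n * c ≤ frobenius a b c + a) ∧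
    ∃ m n, IsLexMin a b c m n ∧ frobenius a b c + a = m * b + n * c := by
  have hF := frobeniusNumber_iff.mp h.frobeniusNumber
  set f := frobenius a b c
  have h3 := h.three_le
  constructor
  · intro m n hmn
    by_contra hlt
    push Not at hlt
    have hmem := hF.2 (m * b + n * c - a) (by omega)
    have := (mem_semigroup_iff_of_isLexMin (s := m * b + n * c - a) hmn (by
      rw [Nat.cast_sub (by omega)]; simp)).mp hmem
    omega
  · obtain ⟨m, n, hmn, hd⟩ := h.exists_isLexMin_of_residue f
    refine ⟨m, n, hmn, ?_⟩
    have h1 : ¬ m * b + n * c ≤ f := fun hle =>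
      hF.1 ((mem_semigroup_iff_of_isLexMin hmn hd).mpr hle)
    have hd' : (a : ℤ) ∣ ((f + a : ℕ) : ℤ) - (m * b + n * c) := by
      have := dvd_add hd (dvd_refl (a : ℤ))
      push_cast
      exact this.trans (Eq.dvd (by ring))
    have h2 := (mem_semigroup_iff_of_isLexMin hmn hd').mp (hF.2 (f + a) (by omega))
    have h4 : (a : ℤ) ∣ ((f + a - (m * b + n * c) : ℕ) : ℤ) := by
      rw [Nat.cast_sub h2]
      exact_mod_cast hd'
    have := Nat.eq_zero_of_dvd_of_lt (Int.natCast_dvd_natCast.mp h4) (by omega)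
    omega

/-! ### Moments of the numerator and the identity for K₂. -/

open Polynomial in
/-- The moment `∑ aₙ n ^ k` of a polynomial `∑ aₙ X ^ n`. -/
noncomputable def moment (k : ℕ) : ℤ[X] →ₗ[ℤ] ℤ :=
  Polynomial.lsum fun n => LinearMap.toSpanSingleton ℤ ℤ ((n : ℤ) ^ k)

open Polynomial in
theorem moment_X_pow (k n : ℕ) : moment k (X ^ n) = (n : ℤ) ^ k := by
  rw [moment, Polynomial.lsum_apply, ← Polynomial.monomial_one_right_eq_X_pow,
    Polynomial.sum_monomial_index] <;> simp

-- The Hilbert series is 1/(1 - t) minus the gap polynomial, and (1 - t^d₁)/(1 - t) is a finite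
-- geometric sum, so the identity lives among polynomials. The constant term is kept as `X ^ 0` so
-- that `moment_X_pow` applies to it.
open Polynomial in
theorem IsMinimalTriple.numerator_eq {d₁ d₂ d₃ x₁ x₂ x₃ y : ℕ} (hd : IsMinimalTriple d₁ d₂ d₃)
    (h : IsSyzygyDegrees d₁ d₂ d₃ x₁ x₂ x₃ y) :
    (X ^ 0 - X ^ x₁ - X ^ x₂ - X ^ x₃ + X ^ y + X ^ g d₁ d₂ d₃ : ℤ[X]) =
      (∑ j ∈ Finset.range d₁, X ^ j) * (1 - X ^ d₂) * (1 - X ^ d₃)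
      - (1 - X ^ d₁) * (1 - X ^ d₂) * (1 - X ^ d₃) * ∑ s ∈ hd.finite_gaps.toFinset, X ^ s := by
  apply Polynomial.coe_injective ℤ
  have hH : hilbertSeries d₁ d₂ d₃ + ((∑ s ∈ hd.finite_gaps.toFinset, X ^ s : ℤ[X]) : PowerSeries ℤ)
      = PowerSeries.mk 1 := by
    classical
    ext n
    simp only [hilbertSeries, map_add, PowerSeries.coeff_mk, Polynomial.coeff_coe,
      Polynomial.finsetSum_coeff, Polynomial.coeff_X_pow, Finset.sum_ite_eq, Pi.one_apply,
      Set.Finite.mem_toFinset, Set.indicator_apply, SetLike.mem_coe]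
    by_cases hn : n ∈ semigroup d₁ d₂ d₃
    · rw [if_pos hn, if_neg fun hg => hg.2 hn, add_zero]
    · rw [if_neg hn, if_pos ⟨Nat.pos_of_ne_zero fun h0 => hn (h0 ▸ zero_mem _), hn⟩, zero_add]
  have hgeom : (1 - PowerSeries.X ^ d₁ : PowerSeries ℤ) * PowerSeries.mk 1 =
      ((∑ j ∈ Finset.range d₁, X ^ j : ℤ[X]) : PowerSeries ℤ) := by
    have h1 : ((∑ j ∈ Finset.range d₁, X ^ j : ℤ[X]) : PowerSeries ℤ) * (1 - PowerSeries.X)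
        = 1 - PowerSeries.X ^ d₁ := by
      have := congrArg (fun p : ℤ[X] => (p : PowerSeries ℤ)) (geom_sum_mul_neg (X : ℤ[X]) d₁)
      simpa only [Polynomial.coe_mul, Polynomial.coe_sub, Polynomial.coe_one, Polynomial.coe_pow,
        Polynomial.coe_X] using this
    rw [← h1, mul_assoc, mul_comm (1 - PowerSeries.X), PowerSeries.mk_one_mul_one_sub_eq_one,
      mul_one]
  have hh := h.hilbert
  rw [eq_sub_of_add_eq hH] at hh
  simp only [Polynomial.coe_mul, Polynomial.coe_sub, Polynomial.coe_add, Polynomial.coe_one,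
    Polynomial.coe_pow, Polynomial.coe_X, pow_zero, ← hgeom]
  rw [← hh]
  ring

theorem IsMinimalTriple.moment_eq {d₁ d₂ d₃ x₁ x₂ x₃ y : ℕ} (hd : IsMinimalTriple d₁ d₂ d₃)
    (h : IsSyzygyDegrees d₁ d₂ d₃ x₁ x₂ x₃ y) (k : ℕ) :
    (0 ^ k - x₁ ^ k - x₂ ^ k - x₃ ^ k + y ^ k + g d₁ d₂ d₃ ^ k : ℚ) =
      (∑ j ∈ Finset.range d₁,
        ((j : ℚ) ^ k - (j + d₂) ^ k - (j + d₃) ^ k + (j + d₂ + d₃) ^ k))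
      - ∑ s ∈ hd.finite_gaps.toFinset,
        ((s : ℚ) ^ k - (s + d₁) ^ k - (s + d₂) ^ k - (s + d₃) ^ k + (s + d₁ + d₂) ^ k
          + (s + d₁ + d₃) ^ k + (s + d₂ + d₃) ^ k - (s + d₁ + d₂ + d₃) ^ k) := by
  have hp := hd.numerator_eq h
  rw [mul_assoc, Finset.sum_mul, Finset.mul_sum] at hp
  have e1 : ∀ j : ℕ, (Polynomial.X ^ j * ((1 - Polynomial.X ^ d₂) * (1 - Polynomial.X ^ d₃)) :
      Polynomial ℤ) = Polynomial.X ^ j - Polynomial.X ^ (j + d₂) - Polynomial.X ^ (j + d₃)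
        + Polynomial.X ^ (j + d₂ + d₃) := fun j => by ring
  have e2 : ∀ s : ℕ, ((1 - Polynomial.X ^ d₁) * (1 - Polynomial.X ^ d₂) * (1 - Polynomial.X ^ d₃)
      * Polynomial.X ^ s : Polynomial ℤ) = Polynomial.X ^ s - Polynomial.X ^ (s + d₁)
        - Polynomial.X ^ (s + d₂) - Polynomial.X ^ (s + d₃) + Polynomial.X ^ (s + d₁ + d₂)
        + Polynomial.X ^ (s + d₁ + d₃) + Polynomial.X ^ (s + d₂ + d₃)
        - Polynomial.X ^ (s + d₁ + d₂ + d₃) := fun s => by ring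
  simp only [e1, e2] at hp
  have hm := congrArg (moment k) hp
  simp only [map_add, map_sub, map_sum, moment_X_pow] at hm
  have := congrArg (Int.cast : ℤ → ℚ) hm
  push_cast at this
  exact this

theorem sum_range_moment_two (n : ℕ) (b c : ℚ) :
    ∑ j ∈ Finset.range n, ((j : ℚ) ^ 2 - (j + b) ^ 2 - (j + c) ^ 2 + (j + b + c) ^ 2)
      = 2 * n * b * c := by
  induction n with
  | zero => simp
  | succ n ih => rw [Finset.sum_range_succ, ih]; push_cast; ring

theorem sum_range_moment_three (n : ℕ) (b c : ℚ) :
    ∑ j ∈ Finset.range n, ((j : ℚ) ^ 3 - (j + b) ^ 3 - (j + c) ^ 3 + (j + b + c) ^ 3)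
      = 3 * n * b * c * (n + b + c - 1) := by
  induction n with
  | zero => simp
  | succ n ih => rw [Finset.sum_range_succ, ih]; push_cast; ring

theorem sum_range_moment_five (n : ℕ) (b c : ℚ) :
    ∑ j ∈ Finset.range n, ((j : ℚ) ^ 5 - (j + b) ^ 5 - (j + c) ^ 5 + (j + b + c) ^ 5)
      = n * b * c * (5 * n * (n - 1) ^ 2 + 5 * (b + c) * (n - 1) * (2 * n - 1)
        + (10 * b ^ 2 + 15 * b * c + 10 * c ^ 2) * (n - 1)
        + 5 * b ^ 3 + 10 * b ^ 2 * c + 10 * b * c ^ 2 + 5 * c ^ 3) := by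
  induction n with
  | zero => simp
  | succ n ih => rw [Finset.sum_range_succ, ih]; push_cast; ring

section

variable {d₁ d₂ d₃ x₁ x₂ x₃ y : ℕ}

theorem IsMinimalTriple.genus_eq (hd : IsMinimalTriple d₁ d₂ d₃) (r : ℕ) :
    genus d₁ d₂ d₃ r = ∑ s ∈ hd.finite_gaps.toFinset, (s : ℚ) ^ r :=
  finsum_mem_eq_finite_toFinset_sum _ hd.finite_gaps

theorem IsMinimalTriple.sum_degrees (hd : IsMinimalTriple d₁ d₂ d₃)
    (h : IsSyzygyDegrees d₁ d₂ d₃ x₁ x₂ x₃ y) :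
    (x₁ + x₂ + x₃ : ℚ) = y + g d₁ d₂ d₃ := by
  have := hd.moment_eq h 1
  rw [Finset.sum_eq_zero (fun j _ => by ring), Finset.sum_eq_zero (fun j _ => by ring)] at this
  linarith

theorem IsMinimalTriple.sum_degrees_sq (hd : IsMinimalTriple d₁ d₂ d₃)
    (h : IsSyzygyDegrees d₁ d₂ d₃ x₁ x₂ x₃ y) :
    (y ^ 2 + g d₁ d₂ d₃ ^ 2 - x₁ ^ 2 - x₂ ^ 2 - x₃ ^ 2 : ℚ) = 2 * (d₁ * d₂ * d₃) := by
  have := hd.moment_eq h 2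
  rw [sum_range_moment_two, Finset.sum_eq_zero (s := hd.finite_gaps.toFinset)
    (fun j _ => by ring)] at this
  linarith

theorem IsMinimalTriple.sum_degrees_cube (hd : IsMinimalTriple d₁ d₂ d₃)
    (h : IsSyzygyDegrees d₁ d₂ d₃ x₁ x₂ x₃ y) :
    (y ^ 3 + g d₁ d₂ d₃ ^ 3 - x₁ ^ 3 - x₂ ^ 3 - x₃ ^ 3 : ℚ)
      = 6 * (d₁ * d₂ * d₃) * K0 d₁ d₂ d₃ := by
  have := hd.moment_eq h 3
  rw [sum_range_moment_three, Finset.sum_congr (s₁ := hd.finite_gaps.toFinset) rfl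
    (g := fun s : ℕ => -(6 * (d₁ * d₂ * d₃) : ℚ) * (s : ℚ) ^ 0) (fun j _ => by ring),
    ← Finset.mul_sum, ← hd.genus_eq] at this
  rw [K0, delta, sigma]
  push_cast
  linear_combination this

/-- The gap terms are third differences, with steps d₁, d₂, d₃, of the fifth power: quadratics in s,
hence combinations of G₂, G₁, G₀. The remaining terms make up the δ part of K₂. -/
theorem IsMinimalTriple.sum_degrees_five (hd : IsMinimalTriple d₁ d₂ d₃)
    (h : IsSyzygyDegrees d₁ d₂ d₃ x₁ x₂ x₃ y) :
    (y ^ 5 + g d₁ d₂ d₃ ^ 5 - x₁ ^ 5 - x₂ ^ 5 - x₃ ^ 5 : ℚ)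
      = 60 * (d₁ * d₂ * d₃) * K2 d₁ d₂ d₃ := by
  have := hd.moment_eq h 5
  rw [sum_range_moment_five, Finset.sum_congr (s₁ := hd.finite_gaps.toFinset) rfl
    (g := fun s : ℕ => -(60 * (d₁ * d₂ * d₃) : ℚ) * (s : ℚ) ^ 2
      + -(60 * (d₁ * d₂ * d₃) * (d₁ + d₂ + d₃) : ℚ) * (s : ℚ) ^ 1
      + -(5 * (d₁ * d₂ * d₃) * (3 * (d₁ + d₂ + d₃) ^ 2 + (d₁ ^ 2 + d₂ ^ 2 + d₃ ^ 2)) : ℚ)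
        * (s : ℚ) ^ 0) (fun j _ => by ring),
    Finset.sum_add_distrib, Finset.sum_add_distrib, ← Finset.mul_sum, ← Finset.mul_sum,
    ← Finset.mul_sum, ← hd.genus_eq, ← hd.genus_eq, ← hd.genus_eq] at this
  rw [K2, delta, delta, sigma, sigma]
  push_cast
  linear_combination this

/-- The identity for `K₂` before rescaling. -/
theorem IsMinimalTriple.twelve_mul_K2 (hd : IsMinimalTriple d₁ d₂ d₃)
    (h : IsSyzygyDegrees d₁ d₂ d₃ x₁ x₂ x₃ y) :
    12 * K2 d₁ d₂ d₃ = (2 * K0 d₁ d₂ d₃ - g d₁ d₂ d₃) * (y + g d₁ d₂ d₃) * y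
      + 2 * K0 d₁ d₂ d₃ * ((g d₁ d₂ d₃ : ℚ) ^ 2 - d₁ * d₂ * d₃) := by
  have h1 := hd.sum_degrees h
  have h2 := hd.sum_degrees_sq h
  have h3 := hd.sum_degrees_cube h
  have h5 := hd.sum_degrees_five h
  have hpos : (d₁ * d₂ * d₃ : ℚ) ≠ 0 := by
    have h3 := hd.three_le
    have h12 := hd.lt₁₂
    have h23 := hd.lt₂₃
    have : 0 < d₁ * d₂ * d₃ := by
      apply Nat.mul_pos (Nat.mul_pos _ _) <;> omega
    exact_mod_cast this.ne'
  generalize (d₁ * d₂ * d₃ : ℚ) = P at *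
  generalize K0 d₁ d₂ d₃ = k at *
  generalize (g d₁ d₂ d₃ : ℚ) = G at *
  generalize (x₃ : ℚ) = x at *
  obtain rfl : x = y + G - x₁ - x₂ := by linarith
  obtain rfl : P = (y ^ 2 + G ^ 2 - x₁ ^ 2 - x₂ ^ 2 - (y + G - x₁ - x₂) ^ 2) / 2 := by linarith
  apply mul_left_cancel₀ hpos
  -- By Newton's identities, for fixed e₁ = y + G and e₂ = yG + P of the xᵢ, the fifth power sum is
  -- affine in the third with slope 5(e₁² - e₂)/3; here e₁² - e₂ = (y + G)y + G² - P.
  linear_combination (-1 / 5 : ℚ) * h5 + (((y + G) * y + G ^ 2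
    - (y ^ 2 + G ^ 2 - x₁ ^ 2 - x₂ ^ 2 - (y + G - x₁ - x₂) ^ 2) / 2) / 3 : ℚ) * h3

end

/-! ### Syzygy degrees read off from the staircase. -/

/-- The generating function of an L-shape. -/
theorem sum_lShape {R : Type*} [CommRing R] (x z : R) (C D E F : ℕ) :
    (1 - x) * (1 - z) * (∑ i ∈ Finset.range C, ∑ j ∈ Finset.range (D + F), x ^ i * z ^ j
      + ∑ i ∈ Finset.Ico C (C + E), ∑ j ∈ Finset.range D, x ^ i * z ^ j)
      = 1 - x ^ (C + E) - z ^ (D + F) - x ^ C * z ^ D + x ^ (C + E) * z ^ D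
        + x ^ C * z ^ (D + F) := by
  rw [← Finset.sum_mul_sum, ← Finset.sum_mul_sum]
  have h1 := geom_sum_mul_neg x C
  have h2 := geom_sum_mul_neg z (D + F)
  have h3 := geom_sum_mul_neg z D
  have h4 := geom_sum_Ico_mul_neg x (Nat.le_add_right C E)
  linear_combination (∑ j ∈ Finset.range (D + F), z ^ j) * (1 - z) * h1 + (1 - x ^ C) * h2
    + (∑ j ∈ Finset.range D, z ^ j) * (1 - z) * h4 + (x ^ C - x ^ (C + E)) * h3

open PowerSeries in
theorem IsMinimalTriple.numerator_of_lShape {a b c C D E F : ℕ} (h : IsMinimalTriple a b c)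
    (hL : ∀ m n, IsLexMin a b c m n ↔ m < C + E ∧ n < D + F ∧ (m < C ∨ n < D)) :
    (1 - X ^ a) * (1 - X ^ b) * (1 - X ^ c) * hilbertSeries a b c
      = 1 - X ^ ((C + E) * b) - X ^ ((D + F) * c) - X ^ (C * b + D * c)
        + X ^ ((C + E) * b + D * c) + X ^ (C * b + (D + F) * c) := by
  classical
  have hdisj : Disjoint (Finset.range C ×ˢ Finset.range (D + F))
      (Finset.Ico C (C + E) ×ˢ Finset.range D) := by
    rw [Finset.disjoint_left]
    rintro ⟨m, n⟩ h1 h2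
    simp only [Finset.mem_product, Finset.mem_range, Finset.mem_Ico] at h1 h2
    omega
  have key := h.one_sub_mul_hilbertSeries
    (L := (Finset.range C ×ˢ Finset.range (D + F)) ∪ (Finset.Ico C (C + E) ×ˢ Finset.range D))
    (fun ⟨m, n⟩ => by
      simp only [hL, Finset.mem_union, Finset.mem_product, Finset.mem_range, Finset.mem_Ico]
      omega)
  rw [Finset.sum_union hdisj, Finset.sum_product, Finset.sum_product] at key
  have := sum_lShape (X ^ b : PowerSeries ℤ) (X ^ c) C D E F
  simp only [← pow_mul, ← pow_add, mul_comm b, mul_comm c] at this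
  rw [← this, ← key]
  ring

/-- Degrees of syzygies exist, and `y` may be taken to be at least the first three degrees. -/
theorem IsMinimalTriple.exists_isSyzygyDegrees {a b c : ℕ} (h : IsMinimalTriple a b c) :
    ∃ x₁ x₂ x₃ y : ℕ, IsSyzygyDegrees a b c x₁ x₂ x₃ y ∧ x₁ ≤ y ∧ x₂ ≤ y ∧ x₃ ≤ y := by
  have h3 := h.three_le
  have h12 := h.lt₁₂
  have h23 := h.lt₂₃
  obtain ⟨hmax, m, n, hmn, hg⟩ := h.frobenius_add
  have hgdef : g a b c = frobenius a b c + a + b + c := by simp only [g, sigma, pow_one]; omega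
  rcases isLexMin_shape (a := a) (b := b) (c := c) (by omega) (by omega) (by omega) with
    ⟨A, B, hA, hB, hAB⟩ | ⟨C, D, E, F, k, l, hC, hD, hE, hF, hk, hl, hL⟩
  · obtain ⟨A, rfl⟩ := Nat.exists_eq_succ_of_ne_zero hA.ne'
    obtain ⟨B, rfl⟩ := Nat.exists_eq_succ_of_ne_zero hB.ne'
    simp only [Nat.succ_eq_add_one] at hAB
    have h1 := hmax A B ((hAB _ _).2 ⟨by omega, by omega⟩)
    obtain ⟨hm, hn⟩ := (hAB _ _).1 hmn
    have h2 : m * b ≤ A * b := Nat.mul_le_mul_right _ (by omega)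
    have h4 : n * c ≤ B * c := Nat.mul_le_mul_right _ (by omega)
    have hgAB : g a b c = (A + 1) * b + (B + 1) * c := by
      rw [add_mul, add_mul]; omega
    -- A rectangle is an L with D = E = 0. Two terms of the numerator then cancel, so x₃ = y is
    -- free; below it is set to the larger of the other two degrees.
    have hnum := h.numerator_of_lShape (C := A + 1) (D := 0) (E := 0) (F := B + 1)
      (fun m n => by rw [hAB]; omega)
    simp only [add_zero, zero_add, zero_mul] at hnum
    rw [← hgAB] at hnum
    have hA' : 0 < (A + 1) * b := Nat.mul_pos hA (by omega)
    have hB' : 0 < (B + 1) * c := Nat.mul_pos hB (by omega)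
    rcases le_total ((A + 1) * b) ((B + 1) * c) with hle | hle
    · exact ⟨(A + 1) * b, (B + 1) * c, (B + 1) * c, (B + 1) * c,
        ⟨by rw [hnum]; ring, by omega, by omega, by omega, by omega⟩, hle, le_rfl, le_rfl⟩
    · exact ⟨(A + 1) * b, (B + 1) * c, (A + 1) * b, (A + 1) * b,
        ⟨by rw [hnum], by omega, by omega, by omega, by omega⟩, le_rfl, hle, le_rfl⟩
  · have hnum := h.numerator_of_lShape hL
    obtain ⟨C, rfl⟩ := Nat.exists_eq_succ_of_ne_zero hC.ne'
    obtain ⟨D, rfl⟩ := Nat.exists_eq_succ_of_ne_zero hD.ne'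
    simp only [Nat.succ_eq_add_one] at *
    -- Equality would make (E, 0) and (0, F) congruent minimal pairs. So the two tips of the L have
    -- different weights, which gives y < g₃.
    have hEF : E * b ≠ F * c := fun heq => by
      have := ((hL E 0).2 ⟨by omega, by omega, by omega⟩).eq (by omega)
        ((hL 0 F).2 ⟨by omega, by omega, by omega⟩) (by
          have : (E * b : ℤ) = F * c := by exact_mod_cast heq
          simp [this])
      omega
    have h1 := hmax (C + E) D ((hL _ _).2 ⟨by omega, by omega, by omega⟩)
    have h2 := hmax C (D + F) ((hL _ _).2 ⟨by omega, by omega, by omega⟩)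
    have h4 : m * b + n * c ≤ (C + E) * b + D * c ∨ m * b + n * c ≤ C * b + (D + F) * c := by
      obtain ⟨hm, hn, hmn' | hmn'⟩ := (hL _ _).1 hmn
      · exact Or.inr (Nat.add_le_add (Nat.mul_le_mul_right _ (by omega))
          (Nat.mul_le_mul_right _ (by omega)))
      · exact Or.inl (Nat.add_le_add (Nat.mul_le_mul_right _ (by omega))
          (Nat.mul_le_mul_right _ (by omega)))
    have hEb : 0 < E * b := Nat.mul_pos hE (by omega)
    have hFc : 0 < F * c := Nat.mul_pos hF (by omega)
    have e1 : (C + 1 + E) * b = C * b + b + E * b := by ring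
    have e2 : (D + 1 + F) * c = D * c + c + F * c := by ring
    have e3 : (C + E) * b = C * b + E * b := by ring
    have e4 : (D + F) * c = D * c + F * c := by ring
    have e5 : (C + 1) * b = C * b + b := by ring
    have e6 : (D + 1) * c = D * c + c := by ring
    rw [e3] at h1 h4
    rw [e4] at h2 h4
    rw [e1] at hk
    rw [e2] at hl
    rw [e1, e2, e5, e6] at hnum
    -- The heavier tip yields g₃ and the lighter one y. That y bounds the remaining xᵢ uses F c ≤ (C
    -- + E) b or E b ≤ (D + F) c (with the original C, D), consequences of `hk` and `hl`.
    rcases lt_or_gt_of_ne hEF with hlt | hlt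
    · have hgY : g a b c = C * b + b + (D * c + c + F * c) := by omega
      rw [← hgY] at hnum
      exact ⟨_, _, _, _, ⟨hnum, by omega, by omega, by omega, by omega⟩,
        by omega, by omega, by omega⟩
    · have hgY : g a b c = C * b + b + E * b + (D * c + c) := by omega
      rw [← hgY] at hnum
      exact ⟨C * b + b + E * b, D * c + c + F * c, C * b + b + (D * c + c),
        C * b + b + (D * c + c + F * c), ⟨by rw [hnum]; ring, by omega, by omega, by omega,
        by omega⟩, by omega, by omega, by omega⟩

/-! ### Rescaling and the bounds. -/

theorem IsMinimalTriple.twelve_mul_h2 {d₁ d₂ d₃ x₁ x₂ x₃ y : ℕ} (hd : IsMinimalTriple d₁ d₂ d₃)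
    (h : IsSyzygyDegrees d₁ d₂ d₃ x₁ x₂ x₃ y) :
    12 * h2 d₁ d₂ d₃ = (2 * h0 d₁ d₂ d₃ - 1) * u d₁ d₂ d₃ y * (u d₁ d₂ d₃ y - 1)
      + 2 * h0 d₁ d₂ d₃ * (1 - v d₁ d₂ d₃) := by
  have hK := hd.twelve_mul_K2 h
  have hg : (g d₁ d₂ d₃ : ℚ) ≠ 0 := by
    have := h.y_lt
    exact_mod_cast (by omega : g d₁ d₂ d₃ ≠ 0)
  simp only [h2, h0, u, v]
  push_cast
  field_simp
  linear_combination hK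

/-- With `p, q, r` the differences between `y` and the first three degrees, normalized to
`g₃ = 1`. -/
theorem bounds_of_nonneg {p q r y v h H : ℚ} (hp : 0 ≤ p) (hq : 0 ≤ q) (hr : 0 ≤ r) (hy : y < 1)
    (hsum : p + q + r = 2 * y - 1) (hv : v = y - y ^ 2 + (p * q + q * r + r * p)) (hv0 : 0 < v)
    (hh : (2 * h - 1) * v = p * q * r)
    (hH : 12 * H = (2 * h - 1) * (1 + y) * y + 2 * h * (1 - v)) :
    1 / 18 < H ∧ H < 1 / 9 := by
  have hy0 : 1 / 2 ≤ y := by linarith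
  have hE2 : 3 * (p * q + q * r + r * p) ≤ (2 * y - 1) ^ 2 := by
    rw [← hsum]
    nlinarith [sq_nonneg (p - q), sq_nonneg (q - r), sq_nonneg (r - p)]
  have hE3 : 9 * (p * q * r) ≤ (p + q + r) * (p * q + q * r + r * p) := by
    nlinarith [mul_nonneg hp (sq_nonneg (q - r)), mul_nonneg hq (sq_nonneg (r - p)),
      mul_nonneg hr (sq_nonneg (p - q))]
  have hE20 : 0 ≤ p * q + q * r + r * p := by positivity
  have hE30 : 0 ≤ p * q * r := by positivity
  -- v ≤ y - y² + (2y - 1)²/3 = (y² - y + 1)/3.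
  have hv3 : v < 1 / 3 := by nlinarith
  -- 9pqr ≤ (2y - 1)(pq + qr + rp) ≤ pq + qr + rp ≤ v, since y² ≤ y ≤ 1.
  have hE4 : 9 * (p * q * r) ≤ v := by nlinarith
  have hw0 : 0 ≤ 2 * h - 1 := by
    by_contra hneg
    push Not at hneg
    nlinarith
  have hw1 : 2 * h - 1 ≤ 1 / 9 := by
    by_contra hlt
    push Not at hlt
    nlinarith
  have hyy : (1 + y) * y ≤ 2 := by nlinarith
  have hyy0 : 0 ≤ (1 + y) * y := by nlinarith
  have h1 : 0 ≤ (2 * h - 1) * ((1 + y) * y) := mul_nonneg hw0 hyy0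
  have h2 : (2 * h - 1) * ((1 + y) * y) ≤ 1 / 9 * 2 := mul_le_mul hw1 hyy hyy0 (by norm_num)
  -- With w = 2h - 1, 12H = w(1 + y)y + (1 + w)(1 - v) lies above 1 - v > 2/3 and, as v > 0, below
  -- 2/9 + 10/9 = 4/3.
  constructor <;> nlinarith

/-- Since h₂ does not depend on the degrees, one choice with every xᵢ ≤ y suffices. -/
theorem IsMinimalTriple.h2_bounds {d₁ d₂ d₃ : ℕ} (hd : IsMinimalTriple d₁ d₂ d₃) :
    1 / 18 < h2 d₁ d₂ d₃ ∧ h2 d₁ d₂ d₃ < 1 / 9 := by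
  obtain ⟨x₁, x₂, x₃, y, h, hx₁, hx₂, hx₃⟩ := hd.exists_isSyzygyDegrees
  have hid := hd.twelve_mul_h2 h
  have e1 := hd.sum_degrees h
  have e2 := hd.sum_degrees_sq h
  have e3 := hd.sum_degrees_cube h
  have hylt : (y : ℚ) < g d₁ d₂ d₃ := by exact_mod_cast h.y_lt
  have hg0 : (0 : ℚ) < g d₁ d₂ d₃ := lt_of_le_of_lt (Nat.cast_nonneg y) hylt
  have hP : (0 : ℚ) < d₁ * d₂ * d₃ := by
    have h3 := hd.three_le
    have h12 := hd.lt₁₂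
    have h23 := hd.lt₂₃
    exact_mod_cast (Nat.mul_pos (Nat.mul_pos (by omega) (by omega)) (by omega) : 0 < d₁ * d₂ * d₃)
  have hx₁' : (x₁ : ℚ) ≤ y := by exact_mod_cast hx₁
  have hx₂' : (x₂ : ℚ) ≤ y := by exact_mod_cast hx₂
  have hx₃' : (x₃ : ℚ) ≤ y := by exact_mod_cast hx₃
  have hvdef : v d₁ d₂ d₃ = d₁ * d₂ * d₃ / (g d₁ d₂ d₃ : ℚ) ^ 2 := by simp [v]
  have hu : u d₁ d₂ d₃ y = 1 + y / g d₁ d₂ d₃ := by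
    rw [u]; field_simp; ring
  have hv0 : 0 < v d₁ d₂ d₃ := by rw [hvdef]; positivity
  refine bounds_of_nonneg (p := (y - x₁) / g d₁ d₂ d₃) (q := (y - x₂) / g d₁ d₂ d₃)
    (r := (y - x₃) / g d₁ d₂ d₃) (y := y / g d₁ d₂ d₃) (v := v d₁ d₂ d₃) (h := h0 d₁ d₂ d₃)
    (div_nonneg (by linarith) hg0.le) (div_nonneg (by linarith) hg0.le)
    (div_nonneg (by linarith) hg0.le) ((div_lt_one hg0).2 hylt) ?_ ?_ hv0 ?_ ?_
  · field_simp
    linarith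
  · rw [hvdef]
    field_simp
    generalize (x₃ : ℚ) = x at *
    obtain rfl : x = y + g d₁ d₂ d₃ - x₁ - x₂ := by linarith
    linear_combination (-1 / 2 : ℚ) * e2
  -- Up to scaling, pqr is the value at y of the monic cubic with roots xᵢ, whose coefficients are
  -- known from the first three power sums.
  · rw [hvdef, h0]
    field_simp
    generalize (x₃ : ℚ) = x at *
    obtain rfl : x = y + g d₁ d₂ d₃ - x₁ - x₂ := by linarith
    linear_combination (-1 / 3 : ℚ) * e3 + (g d₁ d₂ d₃ : ℚ) / 2 * e2
  · rw [hid, hu]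
    ring

end NumSemi3

theorem mainTheorem4 (d₁ d₂ d₃ : ℕ) (hd : NumSemi3.IsMinimalTriple d₁ d₂ d₃) :
    (∃ x₁ x₂ x₃ y : ℕ, NumSemi3.IsSyzygyDegrees d₁ d₂ d₃ x₁ x₂ x₃ y) ∧
    (∀ x₁ x₂ x₃ y : ℕ, NumSemi3.IsSyzygyDegrees d₁ d₂ d₃ x₁ x₂ x₃ y →
      12 * NumSemi3.h2 d₁ d₂ d₃ =
        (2 * NumSemi3.h0 d₁ d₂ d₃ - 1) * NumSemi3.u d₁ d₂ d₃ y * (NumSemi3.u d₁ d₂ d₃ y - 1)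
          + 2 * NumSemi3.h0 d₁ d₂ d₃ * (1 - NumSemi3.v d₁ d₂ d₃)) ∧
    1 / 18 < NumSemi3.h2 d₁ d₂ d₃ ∧ NumSemi3.h2 d₁ d₂ d₃ < 1 / 9 := by
  obtain ⟨x₁, x₂, x₃, y, h, -⟩ := hd.exists_isSyzygyDegrees
  exact ⟨⟨x₁, x₂, x₃, y, h⟩, fun _ _ _ _ => hd.twelve_mul_h2,
    hd.h2_bounds⟩
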